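/- Let $n\ge 1$, let $M\subset\mathbb{R}^n$ be compact and convex, and let $m$ be a probability measure that is absolutely continuous with respect to Lebesgue measure and whose topological support is $M$. For $\varphi:M\to\mathbb{R}$ put $$\varphi^{\mathfrak c}(x)=-\inf_{y\in M}\Big[\tfrac12|x-y|^2+\varphi(y)\Big],\qquad x\in M,$$ and call $\varphi$ $d^2/2$-convex if $\varphi=\psi^{\mathfrak c}$ for some $\psi:M\to\mathbb{R}$. For every probability measure $\mu$ on $M$ there is a $d^2/2$-convex function $\varphi$ on $M$, unique up to an additive constant, with $(\mathrm{Id}+\nabla\varphi)_*m=\mu$ (Brenier–McCann); the conjugate measure of $\mu$ is $$\mu^{\mathfrak c}:=(\mathrm{Id}+\nabla\varphi^{\mathfrak c})_*m .$$ Let $\mu$ be a probability measure on $M$. (i) If $\mu$ is discrete, that is, $\mu=\sum_{i=1}^N\lambda_i\delta_{z_i}$ with $N\in\mathbb{N}\cup\{\infty\}$, then the topological support of $\mu^{\mathfrak c}$ is an $m$-null set. In particular, $\mu^{\mathfrak c}$ has no absolutely continuous part with respect to $m$: every measure $\nu\le\mu^{\mathfrak c}$ with $\nu\ll m$ is zero.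 (ii) If $\mu$ has full topological support, that is, $\operatorname{supp}\mu=M$, then $\mu^{\mathfrak c}$ has no atoms: $\mu^{\mathfrak c}(\{x\})=0$ for every $x$. -/

import Mathlib

open MeasureTheory Set
open scoped ENNReal

noncomputable section

/-- The conjugate (generalized Legendre transform)
`φᶜ(x) = - inf_{y ∈ M} [d(x,y)² / 2 + φ(y)]` of a function on `M`.
Only the values of `φ` on `M` are used. -/
def conjFun {n : ℕ} (M : Set (EuclideanSpace ℝ (Fin n))) (φ : EuclideanSpace ℝ (Fin n) → ℝ) :
    EuclideanSpace ℝ (Fin n) → ℝ :=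
  fun x => -sInf ((fun y => dist x y ^ 2 / 2 + φ y) '' M)

/-- `φ : M → ℝ` is `d²/2`-convex: there is `ψ : M → ℝ` such that
`φ(x) = - inf_{y ∈ M} [d(x,y)² / 2 + ψ(y)]` for all `x ∈ M`, where the infimum is an actual
(finite) greatest lower bound.  Only the values of `φ` and `ψ` on `M` are used. -/
def IsHalfSqDistConvex {n : ℕ} (M : Set (EuclideanSpace ℝ (Fin n)))
    (φ : EuclideanSpace ℝ (Fin n) → ℝ) : Prop :=
  ∃ ψ : EuclideanSpace ℝ (Fin n) → ℝ, ∀ x ∈ M,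
    IsGLB ((fun y => dist x y ^ 2 / 2 + ψ y) '' M) (-φ x)

/-- The map `exp(∇φ) : x ↦ x + ∇φ(x)`.  On the interior of `M` the gradient within `M` is the
usual gradient. -/
def expGrad {n : ℕ} (M : Set (EuclideanSpace ℝ (Fin n))) (φ : EuclideanSpace ℝ (Fin n) → ℝ) :
    EuclideanSpace ℝ (Fin n) → EuclideanSpace ℝ (Fin n) :=
  fun x => x + gradientWithin φ M x

/-- A potential of the Brenier map from `m` to `μ`: a `d²/2`-convex function `φ` on `M` with
`exp(∇φ)_* m = μ`.  When `m` is absolutely continuous with support `M`, it exists for every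
probability measure `μ` on `M` and is unique on `M` up to an additive constant. -/
def brenierPotential {n : ℕ} (M : Set (EuclideanSpace ℝ (Fin n)))
    (m μ : Measure (EuclideanSpace ℝ (Fin n))) : EuclideanSpace ℝ (Fin n) → ℝ :=
  Classical.epsilon fun φ => IsHalfSqDistConvex M φ ∧ m.map (expGrad M φ) = μ

/-- The conjugate measure `μᶜ = exp(∇φᶜ)_* m`, where `exp(∇φ)` is the Brenier map
from `m` to `μ`. -/
def conjMeasure {n : ℕ} (M : Set (EuclideanSpace ℝ (Fin n)))
    (m μ : Measure (EuclideanSpace ℝ (Fin n))) : Measure (EuclideanSpace ℝ (Fin n)) :=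
  m.map (expGrad M (conjFun M (brenierPotential M m μ)))

/-- `μ` is discrete: a finite or countable sum `∑ λ_i δ_{z_i}` of weighted point masses. -/
def IsDiscreteMeasure {n : ℕ} (μ : Measure (EuclideanSpace ℝ (Fin n))) : Prop :=
  ∃ (c : ℕ → ℝ≥0∞) (z : ℕ → EuclideanSpace ℝ (Fin n)),
    μ = Measure.sum fun i => c i • Measure.dirac (z i)

end

open Filter Topology
open scoped RealInnerProductSpace NNReal BoundedContinuousFunction

/-! Adding `‖x‖ ^ 2 / 2` turns `φ` and `φᶜ` into convex functions `u`, `w` that are Legendre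
transforms of each other relative to `M`, and turns the two transport maps into `∇u` and `∇w`
(`exists_isLegendrePair_map_gradient_eq`). Almost every `x` is in contact with `∇u x`, meaning
equality in Fenchel–Young. The points in contact with a fixed `z` form a convex set, whose frontier
is null. On its interior `u` is affine with slope `z`, so `z` is the only partner there
(`eq_of_mem_interior`).

(i) If `∇u` takes countably many values, the interiors of their contact sets form an open set `O` of
full measure. If `∇w y` lies in `O`, then `y` is one of those values, which happens only on a null
set. So `O` misses the support of `μᶜ`.

(ii) If `∇w = x` on a set of positive measure, the contact set of `x` has nonempty interior `V`, and
`∇u` enters `V` only at the point `x`. Then `μ V = 0`, against full support.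

The potential is chosen by `Classical.epsilon`, so its existence has to be proved: a minimiser of
the Kantorovich dual functional exists by Arzelà–Ascoli, and its first variation is the transport
condition. Uniqueness plays no role, since the argument applies to any potential. -/

theorem bddBelow_range_of_continuous {X : Type*} [TopologicalSpace X] {M : Set X}
    (hM : IsCompact M) {f : M → ℝ} (hf : Continuous f) : BddBelow (range f) := by
  have := isCompact_iff_compactSpace.1 hM
  exact (isCompact_range hf).bddBelow

/-! ### Legendre transforms relative to a bounded set -/

section Legendre

variable {E : Type*} [NormedAddCommGroup E] [InnerProductSpace ℝ E] {M : Set E}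

/-- The Legendre transform `x ↦ sup_{y ∈ M} (⟪x, y⟫ - f y)` of a function on `M`. -/
noncomputable def legendre (f : M → ℝ) (x : E) : ℝ := ⨆ y : M, (⟪x, (y : E)⟫ - f y)

theorem bddAbove_range_inner_sub {R : ℝ} (hR : ∀ y ∈ M, ‖y‖ ≤ R) {f : M → ℝ}
    (hf : BddBelow (range f)) (x : E) : BddAbove (range fun y : M => ⟪x, (y : E)⟫ - f y) := by
  obtain ⟨c, hc⟩ := hf
  refine ⟨‖x‖ * R - c, ?_⟩
  rintro _ ⟨y, rfl⟩
  have h1 := real_inner_le_norm x (y : E)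
  have h2 := mul_le_mul_of_nonneg_left (hR y y.2) (norm_nonneg x)
  have h3 := hc ⟨y, rfl⟩
  dsimp only
  linarith

theorem inner_sub_le_legendre {R : ℝ} (hR : ∀ y ∈ M, ‖y‖ ≤ R) {f : M → ℝ}
    (hf : BddBelow (range f)) (x : E) (y : M) : ⟪x, (y : E)⟫ - f y ≤ legendre f x :=
  le_ciSup (bddAbove_range_inner_sub hR hf x) y

theorem legendre_le [Nonempty M] {f : M → ℝ} {x : E} {c : ℝ}
    (h : ∀ y : M, ⟪x, (y : E)⟫ - f y ≤ c) : legendre f x ≤ c :=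
  ciSup_le h

theorem lipschitzWith_legendre [Nonempty M] {R : ℝ≥0} (hR : ∀ y ∈ M, ‖y‖ ≤ R) {f : M → ℝ}
    (hf : BddBelow (range f)) : LipschitzWith R (legendre f) := by
  refine LipschitzWith.of_le_add_mul R fun x x' => legendre_le fun y => ?_
  have h1 := inner_sub_le_legendre hR hf x' y
  have h2 := real_inner_le_norm (x - x') (y : E)
  rw [inner_sub_left] at h2
  have h3 := mul_le_mul_of_nonneg_left (hR y y.2) (norm_nonneg (x - x'))
  rw [dist_eq_norm, mul_comm]
  linarith

theorem legendre_le_legendre_add [Nonempty M] {R : ℝ} (hR : ∀ y ∈ M, ‖y‖ ≤ R) {f g : M → ℝ}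
    (hg : BddBelow (range g)) {c : ℝ} (h : ∀ y, g y ≤ f y + c) (x : E) :
    legendre f x ≤ legendre g x + c :=
  legendre_le fun y => by linarith [inner_sub_le_legendre hR hg x y, h y]

theorem exists_legendre_eq (hM : IsCompact M) [Nonempty M] {f : M → ℝ} (hf : Continuous f)
    (x : E) : ∃ y : M, legendre f x = ⟪x, (y : E)⟫ - f y := by
  have := isCompact_iff_compactSpace.1 hM
  have hc : Continuous fun y : M => ⟪x, (y : E)⟫ - f y := by fun_prop
  obtain ⟨y, -, hy⟩ := isCompact_univ.exists_isMaxOn univ_nonempty hc.continuousOn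
  exact ⟨y, le_antisymm (legendre_le fun z => hy (mem_univ z))
    (le_ciSup (isCompact_range hc).bddAbove y)⟩

theorem legendre_legendre_le [Nonempty M] {R : ℝ} (hR : ∀ y ∈ M, ‖y‖ ≤ R) {f : M → ℝ}
    (hf : BddBelow (range f)) (y : M) :
    legendre (fun x : M => legendre f x) (y : E) ≤ f y :=
  legendre_le fun x => by
    have := inner_sub_le_legendre hR hf x y
    rw [real_inner_comm] at this
    linarith

/-- On `M`, a Legendre transform is equal to its double Legendre transform. -/
theorem legendre_legendre_legendre (hM : IsCompact M) [Nonempty M] {R : ℝ≥0}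
    (hR : ∀ y ∈ M, ‖y‖ ≤ R) {f : M → ℝ} (hf : BddBelow (range f)) (x : M) :
    legendre (fun y : M => legendre (fun x : M => legendre f x) y) (x : E) = legendre f x := by
  have hc : Continuous fun x : M => legendre f x :=
    (lipschitzWith_legendre hR hf).continuous.comp continuous_subtype_val
  have hb := bddBelow_range_of_continuous hM hc
  have hb' : BddBelow (range fun y : M => legendre (fun x : M => legendre f x) (y : E)) :=
    bddBelow_range_of_continuous hM
      ((lipschitzWith_legendre hR hb).continuous.comp continuous_subtype_val)
  refine le_antisymm (legendre_legendre_le hR hb x) (legendre_le fun y => ?_)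
  have h1 := legendre_legendre_le hR hf y
  have h2 := inner_sub_le_legendre hR hb' (x : E) y
  linarith

/-- If `y` attains the supremum defining `legendre f` at a point of differentiability, then `y` is
the gradient. -/
theorem eq_gradient_of_legendre_eq [CompleteSpace E] {R : ℝ} (hR : ∀ y ∈ M, ‖y‖ ≤ R) {f : M → ℝ}
    (hf : BddBelow (range f)) {x : E} {y : M} (hxy : legendre f x = ⟪x, (y : E)⟫ - f y)
    (hd : DifferentiableAt ℝ (legendre f) x) : gradient (legendre f) x = y := by
  -- This difference is at least `-f y` everywhere, with equality at `x`.
  have hmin : IsLocalMin (fun z => legendre f z - ⟪(y : E), z⟫) x :=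
    Eventually.of_forall fun z => by
      have := inner_sub_le_legendre hR hf z y
      rw [real_inner_comm] at this
      rw [real_inner_comm] at hxy
      dsimp only
      linarith
  have h := hmin.hasFDerivAt_eq_zero
    (hd.hasFDerivAt.sub (innerSL ℝ (y : E)).hasFDerivAt)
  apply HasGradientAt.gradient
  rw [hasGradientAt_iff_hasFDerivAt]
  have h' : InnerProductSpace.toDual ℝ E (y : E) = fderiv ℝ (legendre f) x := (sub_eq_zero.1 h).symm
  rw [h']
  exact hd.hasFDerivAt

theorem convex_legendre_le [Nonempty M] {R : ℝ} (hR : ∀ y ∈ M, ‖y‖ ≤ R) {f : M → ℝ}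
    (hf : BddBelow (range f)) (z : E) (c : ℝ) : Convex ℝ {x | legendre f x ≤ ⟪x, z⟫ - c} := by
  have : {x | legendre f x ≤ ⟪x, z⟫ - c} =
      ⋂ y : M, {x | ⟪(y : E) - z, x⟫ ≤ f y - c} := by
    ext x
    simp only [mem_ofPred_eq, mem_iInter, inner_sub_left]
    refine ⟨fun h y => ?_, fun h => legendre_le fun y => ?_⟩
    · have := inner_sub_le_legendre hR hf x y
      rw [real_inner_comm x, real_inner_comm x]
      linarith
    · have := h y
      rw [real_inner_comm x, real_inner_comm x] at this
      linarith
  rw [this]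
  exact convex_iInter fun y => convex_halfSpace_le (innerSL ℝ ((y : E) - z)).isLinear _

/-- The points of `M × M` at which the Fenchel–Young inequality is an equality, described for a
fixed second coordinate. -/
def contactSet (M : Set E) (u w : E → ℝ) (z : E) : Set E := {x | x ∈ M ∧ u x + w z = ⟪x, z⟫}

/-- If the Legendre transform of `w` is affine near `x`, then its slope is the only point in
contact with `x`. -/
theorem eq_of_mem_interior_contactSet {R : ℝ} (hR : ∀ y ∈ M, ‖y‖ ≤ R) {w : E → ℝ}
    (hw : BddBelow (range fun y : M => w y)) {x y z : E}
    (hx : x ∈ interior (contactSet M (legendre fun y : M => w y) w z)) (hy : y ∈ M)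
    (hxy : legendre (fun y : M => w y) x + w y = ⟪x, y⟫) : y = z := by
  -- Near `x` the transform is `⟪p, z⟫ - w z`, so Fenchel–Young at `y` bounds `⟪z - y, p⟫` below by
  -- `w z - w y`, attained at `x`. A linear form with a local minimum vanishes.
  have hmin : IsLocalMin (fun p => ⟪z - y, p⟫) x := by
    have hxz := (interior_subset hx).2
    filter_upwards [mem_interior_iff_mem_nhds.1 hx] with p hp
    have h1 := hp.2
    have h2 := inner_sub_le_legendre hR hw p ⟨y, hy⟩
    simp only at h2
    rw [inner_sub_left, inner_sub_left, real_inner_comm p, real_inner_comm x, real_inner_comm p,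
      real_inner_comm x]
    linarith
  have h := hmin.hasFDerivAt_eq_zero (innerSL ℝ (z - y)).hasFDerivAt
  have h' : ⟪z - y, z - y⟫ = 0 := DFunLike.congr_fun h (z - y)
  rw [inner_self_eq_zero, sub_eq_zero] at h'
  exact h'.symm

end Legendre

/-! ### Gradients and almost-everywhere regularity -/

section Gradient

variable {n : ℕ} {M : Set (EuclideanSpace ℝ (Fin n))}

/-- The gradient of `‖x‖ ^ 2 / 2` is `x`, which cancels the identity in `expGrad`. -/
theorem expGrad_eq_gradient {φ u : EuclideanSpace ℝ (Fin n) → ℝ}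
    (h : ∀ x ∈ M, φ x = u x - ‖x‖ ^ 2 / 2) {x : EuclideanSpace ℝ (Fin n)} (hx : x ∈ interior M)
    (hd : DifferentiableAt ℝ u x) : expGrad M φ x = gradient u x := by
  have hMx := mem_interior_iff_mem_nhds.1 hx
  have he : φ =ᶠ[𝓝 x] fun x => u x - ‖x‖ ^ 2 / 2 := by
    filter_upwards [hMx] with y hy using h y hy
  have h2 : HasFDerivAt (fun x : EuclideanSpace ℝ (Fin n) => ‖x‖ ^ 2 / 2) (innerSL ℝ x) x := by
    have h1 := (hasStrictFDerivAt_norm_sq x).hasFDerivAt.mul_const (1 / 2 : ℝ)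
    have h2 : (1 / 2 : ℝ) • 2 • innerSL ℝ x = innerSL ℝ x := by
      ext y
      simp
    rw [h2] at h1
    simpa only [mul_one_div] using h1
  have h3 := (hd.hasFDerivAt.sub h2).congr_of_eventuallyEq he
  have h4 : HasGradientAt φ (gradient u x - x) x := by
    rw [hasGradientAt_iff_hasFDerivAt, map_sub, toDual_gradient]
    exact h3
  have h5 : gradientWithin φ M x = gradient φ x := by
    simp only [gradientWithin, gradient, fderivWithin_of_mem_nhds hMx]
  rw [expGrad, h5, h4.gradient]
  abel

theorem measurable_gradient (u : EuclideanSpace ℝ (Fin n) → ℝ) : Measurable (gradient u) :=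
  (InnerProductSpace.toDual ℝ _).symm.continuous.measurable.comp (measurable_fderiv ℝ u)

theorem ae_mem_interior_of_convex {m : Measure (EuclideanSpace ℝ (Fin n))} (hm : m ≪ volume)
    {s : Set (EuclideanSpace ℝ (Fin n))} (hs : Convex ℝ s) : ∀ᵐ x ∂m, x ∈ s → x ∈ interior s := by
  have h := hm (hs.addHaar_frontier volume)
  filter_upwards [measure_eq_zero_iff_ae_notMem.1 h] with x hx hxs
  by_contra hi
  exact hx ⟨subset_closure hxs, hi⟩

theorem LipschitzWith.ae_differentiableAt_of_absolutelyContinuous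
    {m : Measure (EuclideanSpace ℝ (Fin n))} (hm : m ≪ volume)
    {u : EuclideanSpace ℝ (Fin n) → ℝ} {R : ℝ≥0} (hu : LipschitzWith R u) :
    ∀ᵐ x ∂m, DifferentiableAt ℝ u x :=
  hm.ae_le hu.ae_differentiableAt

theorem expGrad_ae_eq_gradient {m : Measure (EuclideanSpace ℝ (Fin n))} (hm : m ≪ volume)
    (hM : Convex ℝ M) (hmM : m Mᶜ = 0) {φ u : EuclideanSpace ℝ (Fin n) → ℝ}
    (h : ∀ x ∈ M, φ x = u x - ‖x‖ ^ 2 / 2) {R : ℝ≥0} (hu : LipschitzWith R u) :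
    expGrad M φ =ᵐ[m] gradient u := by
  have h1 : ∀ᵐ x ∂m, x ∈ M := hmM
  filter_upwards [h1, ae_mem_interior_of_convex hm hM,
    hu.ae_differentiableAt_of_absolutelyContinuous hm] with x hx hxi hd
  exact expGrad_eq_gradient h (hxi hx) hd

end Gradient

/-! ### Contact sets of a conjugate pair -/

/-- Two continuous functions that are Legendre transforms of each other relative to `M`. -/
structure IsLegendrePair {E : Type*} [NormedAddCommGroup E] [InnerProductSpace ℝ E] (M : Set E)
    (u w : E → ℝ) : Prop where
  continuous_left : Continuous u
  continuous_right : Continuous w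
  left_eq : u = legendre fun y : M => w y
  right_eq : w = legendre fun x : M => u x

namespace IsLegendrePair

section Basic

variable {E : Type*} [NormedAddCommGroup E] [InnerProductSpace ℝ E] {M : Set E} {u w : E → ℝ}

theorem symm (h : IsLegendrePair M u w) : IsLegendrePair M w u :=
  ⟨h.continuous_right, h.continuous_left, h.right_eq, h.left_eq⟩

theorem bddBelow_right (h : IsLegendrePair M u w) (hM : IsCompact M) :
    BddBelow (range fun y : M => w y) :=
  bddBelow_range_of_continuous hM (h.continuous_right.comp continuous_subtype_val)

theorem lipschitzWith_left (h : IsLegendrePair M u w) (hM : IsCompact M) [Nonempty M] {R : ℝ≥0}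
    (hR : ∀ y ∈ M, ‖y‖ ≤ R) : LipschitzWith R u :=
  h.left_eq ▸ lipschitzWith_legendre hR (h.bddBelow_right hM)

theorem mem_contactSet_comm {x y : E} (hx : x ∈ M) (hy : y ∈ M) :
    x ∈ contactSet M u w y ↔ y ∈ contactSet M w u x := by
  simp only [contactSet, mem_ofPred_eq, hx, hy, true_and]
  rw [add_comm, real_inner_comm]

/-- One half of the equality is Fenchel–Young; the other half cuts out a sublevel set of a convex
function. -/
theorem convex_contactSet (h : IsLegendrePair M u w) (hM : IsCompact M) (hMc : Convex ℝ M)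
    [Nonempty M] {R : ℝ≥0} (hR : ∀ y ∈ M, ‖y‖ ≤ R) {z : E} (hz : z ∈ M) :
    Convex ℝ (contactSet M u w z) := by
  have hb := h.bddBelow_right hM
  convert hMc.inter (convex_legendre_le hR hb z (w z)) using 1
  ext x
  rw [← h.left_eq]
  refine and_congr_right fun _ => ⟨fun hx => ?_, fun hx => le_antisymm ?_ ?_⟩
  · simp only [mem_ofPred_eq]
    linarith
  · simp only [mem_ofPred_eq] at hx
    linarith
  · have := inner_sub_le_legendre hR hb x ⟨z, hz⟩
    rw [← h.left_eq] at this
    simp only at this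
    linarith

theorem eq_of_mem_interior (h : IsLegendrePair M u w) (hM : IsCompact M)
    {R : ℝ≥0} (hR : ∀ y ∈ M, ‖y‖ ≤ R) {x y z : E} (hx : x ∈ interior (contactSet M u w z))
    (hy : y ∈ M) (hxy : x ∈ contactSet M u w y) : y = z := by
  refine eq_of_mem_interior_contactSet (w := w) (x := x) hR (h.bddBelow_right hM) ?_ hy ?_
  · rwa [← h.left_eq]
  · rw [← h.left_eq]
    exact hxy.2

end Basic

variable {n : ℕ} {M : Set (EuclideanSpace ℝ (Fin n))} {u w : EuclideanSpace ℝ (Fin n) → ℝ}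
  {m : Measure (EuclideanSpace ℝ (Fin n))}

/-- Compactness gives a maximiser in the transform, and at a point of differentiability it must be
the gradient. -/
theorem ae_mem_contactSet (h : IsLegendrePair M u w) (hM : IsCompact M) [Nonempty M]
    (hm : m ≪ volume) (hmM : m Mᶜ = 0) :
    ∀ᵐ x ∂m, gradient u x ∈ M ∧ x ∈ contactSet M u w (gradient u x) := by
  obtain ⟨R, hR0, hR⟩ := hM.isBounded.exists_pos_norm_le
  lift R to ℝ≥0 using hR0.le
  have h1 : ∀ᵐ x ∂m, x ∈ M := hmM
  filter_upwards [h1, (h.lipschitzWith_left hM hR).ae_differentiableAt_of_absolutelyContinuous hm]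
    with x hx hd
  obtain ⟨y, hy⟩ := exists_legendre_eq hM (h.continuous_right.comp continuous_subtype_val) x
  have hyg : gradient u x = y := by
    have hd' := hd
    rw [h.left_eq] at hd' ⊢
    exact eq_gradient_of_legendre_eq hR (h.bddBelow_right hM) hy hd'
  rw [hyg]
  refine ⟨y.2, hx, ?_⟩
  have hy' : legendre (fun y : M => w y) x = ⟪x, (y : EuclideanSpace ℝ (Fin n))⟫ - w y := hy
  rw [← h.left_eq] at hy'
  linarith

/-- If the gradient of `u` takes only countably many values almost everywhere, then the gradient of
the conjugate function avoids an open set of full measure. -/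
theorem exists_isOpen_of_countable [NullSingletonClass m] (h : IsLegendrePair M u w) (hM : IsCompact M)
    (hMc : Convex ℝ M) [Nonempty M] (hm : m ≪ volume) (hmM : m Mᶜ = 0)
    {D : Set (EuclideanSpace ℝ (Fin n))} (hD : D.Countable) (hu : ∀ᵐ x ∂m, gradient u x ∈ D) :
    ∃ O : Set (EuclideanSpace ℝ (Fin n)), IsOpen O ∧ m Oᶜ = 0 ∧ ∀ᵐ y ∂m, gradient w y ∉ O := by
  obtain ⟨R, hR0, hR⟩ := hM.isBounded.exists_pos_norm_le
  lift R to ℝ≥0 using hR0.le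
  refine ⟨⋃ z ∈ D ∩ M, interior (contactSet M u w z),
    isOpen_biUnion fun _ _ => isOpen_interior, ?_, ?_⟩
  · have h1 : ∀ᵐ x ∂m, ∀ z ∈ D ∩ M, x ∈ contactSet M u w z → x ∈ interior (contactSet M u w z) :=
      (ae_ball_iff (hD.mono inter_subset_left)).2 fun z hz =>
        ae_mem_interior_of_convex hm (h.convex_contactSet hM hMc hR hz.2)
    have h2 : ∀ᵐ x ∂m, x ∈ ⋃ z ∈ D ∩ M, interior (contactSet M u w z) := by
      filter_upwards [h1, hu, h.ae_mem_contactSet hM hm hmM] with x hx hxD hxc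
      exact mem_biUnion ⟨hxD, hxc.1⟩ (hx _ ⟨hxD, hxc.1⟩ hxc.2)
    exact h2
  · have h1 : ∀ᵐ y ∂m, y ∈ M := hmM
    filter_upwards [h1, h.symm.ae_mem_contactSet hM hm hmM, hD.ae_notMem m] with y hyM hy hyD hyO
    obtain ⟨z, hz, hyz⟩ := mem_iUnion₂.1 hyO
    have := h.eq_of_mem_interior hM hR hyz hyM ((mem_contactSet_comm hy.1 hyM).2 hy.2)
    exact hyD (this ▸ hz.1)

/-- If the values of the gradient of `u` are essentially dense in `M`, then the gradient of the
conjugate function has null fibres. -/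
theorem measure_gradient_eq_null [NullSingletonClass m] (h : IsLegendrePair M u w) (hM : IsCompact M)
    (hMc : Convex ℝ M) [Nonempty M] (hm : m ≪ volume) (hmM : m Mᶜ = 0)
    (hu : ∀ V : Set (EuclideanSpace ℝ (Fin n)), IsOpen V → V.Nonempty → V ⊆ M →
      ¬ ∀ᵐ x ∂m, gradient u x ∉ V) (x : EuclideanSpace ℝ (Fin n)) :
    ∀ᵐ y ∂m, gradient w y ≠ x := by
  obtain ⟨R, hR0, hR⟩ := hM.isBounded.exists_pos_norm_le
  lift R to ℝ≥0 using hR0.le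
  by_cases hx : x ∈ M
  -- Otherwise this interior is a forbidden `V`: if `∇u x'` lies in it, then `x' = x`, and a point
  -- is null.
  · have hempty : interior (contactSet M w u x) = ∅ := by
      by_contra hne
      refine hu _ isOpen_interior (nonempty_iff_ne_empty.2 hne)
        (interior_subset.trans fun y hy => hy.1) ?_
      have h1 : ∀ᵐ x' ∂m, x' ∈ M := hmM
      filter_upwards [h1, h.ae_mem_contactSet hM hm hmM, (countable_singleton x).ae_notMem m]
        with x' hx'M hx' hne' hV
      exact hne' (h.symm.eq_of_mem_interior hM hR hV hx'M
        ((mem_contactSet_comm hx'M hx'.1).1 hx'.2))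
    filter_upwards [h.symm.ae_mem_contactSet hM hm hmM,
      ae_mem_interior_of_convex hm (h.symm.convex_contactSet hM hMc hR hx)] with y hy hyi hyx
    rw [hyx] at hy
    have := hyi hy.2
    rw [hempty] at this
    exact this
  · filter_upwards [h.symm.ae_mem_contactSet hM hm hmM] with y hy hyx
    exact hx (hyx ▸ hy.1)

end IsLegendrePair

/-! ### From `d²/2`-convex functions to conjugate pairs -/

section Potential

variable {n : ℕ} {M : Set (EuclideanSpace ℝ (Fin n))}

theorem half_dist_sq_eq (x y : EuclideanSpace ℝ (Fin n)) :
    dist x y ^ 2 / 2 = ‖x‖ ^ 2 / 2 + ‖y‖ ^ 2 / 2 - ⟪x, y⟫ := by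
  rw [dist_eq_norm, norm_sub_sq_real]
  ring

theorem conjFun_eq [Nonempty M] {φ u : EuclideanSpace ℝ (Fin n) → ℝ}
    (h : ∀ x ∈ M, φ x = u x - ‖x‖ ^ 2 / 2) (y : EuclideanSpace ℝ (Fin n))
    (hb : BddAbove (range fun x : M => ⟪y, (x : EuclideanSpace ℝ (Fin n))⟫ - u x)) :
    conjFun M φ y = legendre (fun x : M => u x) y - ‖y‖ ^ 2 / 2 := by
  have hlub := isLUB_ciSup hb
  have hglb : IsGLB ((fun x => dist y x ^ 2 / 2 + φ x) '' M)
      (-(legendre (fun x : M => u x) y - ‖y‖ ^ 2 / 2)) := by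
    constructor
    · rintro _ ⟨x, hx, rfl⟩
      have := hlub.1 ⟨⟨x, hx⟩, rfl⟩
      simp only [half_dist_sq_eq, h x hx, legendre] at this ⊢
      linarith
    · intro c hc
      have : legendre (fun x : M => u x) y ≤ ‖y‖ ^ 2 / 2 - c := legendre_le fun x => by
        have := hc ⟨x, x.2, rfl⟩
        simp only [half_dist_sq_eq, h x x.2] at this
        linarith
      linarith
  rw [conjFun, hglb.csInf_eq ((nonempty_coe_sort.1 ‹_›).image _), neg_neg]

theorem isHalfSqDistConvex_of_legendre (hM : IsCompact M) [Nonempty M] {f : M → ℝ}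
    (hf : Continuous f) : IsHalfSqDistConvex M fun x => legendre f x - ‖x‖ ^ 2 / 2 := by
  obtain ⟨R, hR0, hR⟩ := hM.isBounded.exists_pos_norm_le
  have hb := bddBelow_range_of_continuous hM hf
  -- The default value `0` outside `M` is never read.
  refine ⟨Function.extend Subtype.val (fun y : M => f y - ‖(y : EuclideanSpace ℝ (Fin n))‖ ^ 2 / 2)
    0, fun x _ => ⟨?_, fun c hc => ?_⟩⟩
  · rintro _ ⟨y, hy, rfl⟩
    have h1 := Subtype.val_injective.extend_apply
      (fun y : M => f y - ‖(y : EuclideanSpace ℝ (Fin n))‖ ^ 2 / 2) 0 ⟨y, hy⟩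
    have h2 := inner_sub_le_legendre hR hb x ⟨y, hy⟩
    simp only [half_dist_sq_eq] at h1 h2 ⊢
    rw [h1]
    linarith
  · have : legendre f x ≤ ‖x‖ ^ 2 / 2 - c := legendre_le fun y => by
      have h1 := hc ⟨y, y.2, rfl⟩
      simp only [half_dist_sq_eq, Subtype.val_injective.extend_apply] at h1
      linarith
    linarith

theorem IsHalfSqDistConvex.exists_isLegendrePair (hM : IsCompact M) [Nonempty M]
    {φ : EuclideanSpace ℝ (Fin n) → ℝ} (hφ : IsHalfSqDistConvex M φ) :
    ∃ u w, IsLegendrePair M u w ∧ (∀ x ∈ M, φ x = u x - ‖x‖ ^ 2 / 2) ∧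
      ∀ y, conjFun M φ y = w y - ‖y‖ ^ 2 / 2 := by
  obtain ⟨R, hR0, hR⟩ := hM.isBounded.exists_pos_norm_le
  lift R to ℝ≥0 using hR0.le
  obtain ⟨ψ, hψ⟩ := hφ
  set f : M → ℝ := fun y => ψ y + ‖(y : EuclideanSpace ℝ (Fin n))‖ ^ 2 / 2 with hf
  -- Finiteness of the infimum at a single point already bounds `f` below.
  have hb : BddBelow (range f) := by
    obtain ⟨x⟩ := ‹Nonempty M›
    refine ⟨-φ x - ‖(x : EuclideanSpace ℝ (Fin n))‖ ^ 2 / 2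
      - ‖(x : EuclideanSpace ℝ (Fin n))‖ * R, ?_⟩
    rintro _ ⟨y, rfl⟩
    have h1 := (hψ x x.2).1 ⟨y, y.2, rfl⟩
    have h2 := neg_le_of_abs_le
      (abs_real_inner_le_norm (x : EuclideanSpace ℝ (Fin n)) (y : EuclideanSpace ℝ (Fin n)))
    have h3 := mul_le_mul_of_nonneg_left (hR y y.2) (norm_nonneg (x : EuclideanSpace ℝ (Fin n)))
    simp only [half_dist_sq_eq, hf] at h1 ⊢
    linarith
  have hlip := lipschitzWith_legendre hR hb
  have hb1 := bddBelow_range_of_continuous hM (hlip.continuous.comp continuous_subtype_val)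
  have hlip1 := lipschitzWith_legendre hR hb1
  have hb2 := bddBelow_range_of_continuous hM (hlip1.continuous.comp continuous_subtype_val)
  have hlip2 := lipschitzWith_legendre hR hb2
  have htriple := legendre_legendre_legendre hM hR hb
  -- The pair is `u = f***`, `w = f**`: `f` itself need not be continuous, and `f*` is known to
  -- equal `f***` only on `M`, while the pair must satisfy its identities on the whole space.
  have hw : (legendre fun x : M => legendre
      (fun y : M => legendre (fun x : M => legendre f x) y) (x : EuclideanSpace ℝ (Fin n)))
      = legendre fun x : M => legendre f x := by
    simp only [htriple]
  have hφu : ∀ x ∈ M, φ x = legendre (fun y : M => legendre (fun x : M => legendre f x) y) x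
      - ‖x‖ ^ 2 / 2 := by
    intro x hx
    rw [htriple ⟨x, hx⟩]
    refine neg_injective ((hψ x hx).unique ?_)
    constructor
    · rintro _ ⟨y, hy, rfl⟩
      have := inner_sub_le_legendre hR hb x ⟨y, hy⟩
      simp only [half_dist_sq_eq, hf] at this ⊢
      linarith
    · intro c hc
      have : legendre f x ≤ ‖x‖ ^ 2 / 2 - c := legendre_le fun y => by
        have := hc ⟨y, y.2, rfl⟩
        simp only [half_dist_sq_eq, hf] at this ⊢
        linarith
      linarith
  refine ⟨_, _, ⟨hlip2.continuous, hlip1.continuous, rfl, hw.symm⟩, hφu, fun y => ?_⟩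
  rw [conjFun_eq hφu y (bddAbove_range_inner_sub hR (bddBelow_range_of_continuous hM
    (hlip2.continuous.comp continuous_subtype_val)) y)]
  exact congrArg (fun t => t - ‖y‖ ^ 2 / 2) (congrFun hw y)

end Potential

/-! ### The Kantorovich dual problem -/

theorem integrable_of_continuous_of_compl_null {X : Type*} [TopologicalSpace X] [T2Space X]
    [MeasurableSpace X] [BorelSpace X] {M : Set X} {m : Measure X} [IsFiniteMeasure m]
    (hM : IsCompact M) (hmM : m Mᶜ = 0) {u : X → ℝ} (hu : Continuous u) : Integrable u m := by
  have h := hu.continuousOn.integrableOn_compact (μ := m) hM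
  rwa [IntegrableOn, Measure.restrict_eq_self_of_ae_mem (show ∀ᵐ x ∂m, x ∈ M from hmM)] at h

section DualProblem

variable {E : Type*} [NormedAddCommGroup E] [InnerProductSpace ℝ E] {M : Set E}

theorem legendre_le_legendre_add_dist [Nonempty M] {R : ℝ} (hR : ∀ y ∈ M, ‖y‖ ≤ R)
    (hM : IsCompact M) (f g : M →ᵇ ℝ) (x : E) : legendre f x ≤ legendre g x + dist f g := by
  refine legendre_le_legendre_add hR (bddBelow_range_of_continuous hM g.continuous) (fun y => ?_) x
  have := f.dist_coe_le_dist (g := g) y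
  rw [Real.dist_eq] at this
  linarith [(abs_le.1 this).1]

theorem abs_legendre_sub_le_dist [Nonempty M] {R : ℝ} (hR : ∀ y ∈ M, ‖y‖ ≤ R)
    (hM : IsCompact M) (f g : M →ᵇ ℝ) (x : E) : |legendre f x - legendre g x| ≤ dist f g := by
  have h1 := legendre_le_legendre_add_dist hR hM f g x
  have h2 := legendre_le_legendre_add_dist hR hM g f x
  rw [dist_comm] at h2
  exact abs_le.2 ⟨by linarith, by linarith⟩

/-- If the supremum defining `legendre f x` is attained only at `y₀`, then
`t ↦ legendre (f + t g) x` has derivative `- g y₀` at zero. -/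
theorem tendsto_legendre_slope [Nonempty M] {R : ℝ} (hR : ∀ y ∈ M, ‖y‖ ≤ R)
    (hM : IsCompact M) (f g : M →ᵇ ℝ) {x : E} {y₀ : M}
    (h₀ : ∀ y : M, legendre f x = ⟪x, (y : E)⟫ - f y → y = y₀)
    {t : ℕ → ℝ} (ht : ∀ k, 0 < t k) (ht0 : Tendsto t atTop (𝓝 0)) :
    Tendsto (fun k => (t k)⁻¹ * (legendre (f + t k • g) x - legendre f x)) atTop (𝓝 (-g y₀)) := by
  have := isCompact_iff_compactSpace.1 hM
  have hb (f : M →ᵇ ℝ) := bddBelow_range_of_continuous hM f.continuous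
  have hy₀ : legendre f x = ⟪x, (y₀ : E)⟫ - f y₀ := by
    obtain ⟨y, hy⟩ := exists_legendre_eq hM f.continuous x
    rwa [h₀ y hy] at hy
  have hadd (k : ℕ) (z : M) : (f + t k • g) z = f z + t k * g z := rfl
  choose y hy using fun k => exists_legendre_eq hM (f + t k • g).continuous x
  simp only [hadd] at hy
  have hgy (z : M) : |g z| ≤ ‖g‖ := g.norm_coe_le_norm z
  have hlow (k : ℕ) : legendre f x - t k * g y₀ ≤ legendre (f + t k • g) x := by
    have := inner_sub_le_legendre hR (hb (f + t k • g)) x y₀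
    rw [hadd] at this
    linarith
  have hval : Tendsto (fun k => ⟪x, (y k : E)⟫ - f (y k)) atTop (𝓝 (legendre f x)) := by
    have hl : Tendsto (fun k => legendre f x - t k * (2 * ‖g‖)) atTop (𝓝 (legendre f x)) := by
      simpa using (ht0.mul_const (2 * ‖g‖)).const_sub (legendre f x)
    refine tendsto_of_tendsto_of_tendsto_of_le_of_le hl tendsto_const_nhds (fun k => ?_)
      fun k => inner_sub_le_legendre hR (hb f) x (y k)
    have h1 := hlow k
    have h2 := mul_le_mul_of_nonneg_left (abs_le.1 (hgy y₀)).2 (ht k).le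
    have h3 := mul_le_mul_of_nonneg_left (abs_le.1 (hgy (y k))).1 (ht k).le
    have h4 := hy k
    dsimp only
    linarith
  -- By `hval`, every cluster point of the perturbed maximisers maximises the unperturbed problem,
  -- hence is `y₀`. The slope is then squeezed between `-g y₀` and `-g (y k)`.
  have hytend : Tendsto y atTop (𝓝 y₀) := by
    refine tendsto_nhds_of_unique_mapClusterPt fun z hz => h₀ z ?_
    have hcont : Continuous fun y : M => ⟪x, (y : E)⟫ - f y := by fun_prop
    have hcl := hz.continuousAt_comp hcont.continuousAt
    have : (𝓝 (⟪x, (z : E)⟫ - f z) ⊓ 𝓝 (legendre f x)).NeBot := ClusterPt.mono hcl hval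
    exact (eq_of_nhds_neBot this).symm
  have hup : Tendsto (fun k => -g (y k)) atTop (𝓝 (-g y₀)) :=
    ((g.continuous.tendsto y₀).comp hytend).neg
  refine tendsto_of_tendsto_of_tendsto_of_le_of_le tendsto_const_nhds hup (fun k => ?_) fun k => ?_
  · rw [← div_eq_inv_mul, le_div_iff₀ (ht k)]
    linarith [hlow k]
  · dsimp only
    rw [← div_eq_inv_mul, div_le_iff₀ (ht k)]
    linarith [hy k, inner_sub_le_legendre hR (hb f) x (y k)]

variable [MeasurableSpace E] [BorelSpace E]

/-- The functional minimised in the dual optimal transport problem. -/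
noncomputable def dualFunctional (m : Measure E) (ν : Measure M) (f : M →ᵇ ℝ) : ℝ :=
  ∫ x, legendre f x ∂m + ∫ y, f y ∂ν

variable {m : Measure E} [IsProbabilityMeasure m] {ν : Measure M} [IsProbabilityMeasure ν]

theorem integrable_legendre [Nonempty M] (hM : IsCompact M) (hmM : m Mᶜ = 0) (f : M →ᵇ ℝ) :
    Integrable (legendre f) m := by
  obtain ⟨R, hR0, hR⟩ := hM.isBounded.exists_pos_norm_le
  lift R to ℝ≥0 using hR0.le
  exact integrable_of_continuous_of_compl_null hM hmM
    (lipschitzWith_legendre hR (bddBelow_range_of_continuous hM f.continuous)).continuous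

theorem dualFunctional_le_add [Nonempty M] (hM : IsCompact M) (hmM : m Mᶜ = 0) (f g : M →ᵇ ℝ) :
    dualFunctional m ν f ≤ dualFunctional m ν g + 2 * dist f g := by
  obtain ⟨R, hR0, hR⟩ := hM.isBounded.exists_pos_norm_le
  have h1 : ∫ x, legendre f x ∂m ≤ ∫ x, (legendre g x + dist f g) ∂m :=
    integral_mono (integrable_legendre hM hmM f)
      ((integrable_legendre hM hmM g).add (integrable_const _))
      (legendre_le_legendre_add_dist hR hM f g)
  have h2 : ∫ y, f y ∂ν ≤ ∫ y, (g y + dist f g) ∂ν :=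
    integral_mono (f.integrable ν) ((g.integrable ν).add (integrable_const _)) fun y => by
      have := f.dist_coe_le_dist (g := g) y
      rw [Real.dist_eq] at this
      linarith [(abs_le.1 this).2]
  rw [integral_add (integrable_legendre hM hmM g) (integrable_const _)] at h1
  rw [integral_add (g.integrable ν) (integrable_const _)] at h2
  simp only [integral_const, probReal_univ, one_smul] at h1 h2
  simp only [dualFunctional]
  linarith

/-- Every function can be replaced by a Lipschitz one normalised at a point without increasing the
dual functional. -/
theorem exists_lipschitzWith_dualFunctional_le (hM : IsCompact M) (hmM : m Mᶜ = 0) {R : ℝ≥0}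
    (hR : ∀ y ∈ M, ‖y‖ ≤ R) (y₀ : M) (f : M →ᵇ ℝ) :
    ∃ g : M →ᵇ ℝ, LipschitzWith R g ∧ g y₀ = 0 ∧
      dualFunctional m ν g ≤ dualFunctional m ν f := by
  have : Nonempty M := ⟨y₀⟩
  have := isCompact_iff_compactSpace.1 hM
  have hb := bddBelow_range_of_continuous hM f.continuous
  have hb1 : BddBelow (range fun x : M => legendre f x) := bddBelow_range_of_continuous hM
    ((lipschitzWith_legendre hR hb).continuous.comp continuous_subtype_val)
  have hlip := lipschitzWith_legendre hR hb1
  -- The biconjugate lies below `f` on `M`, and its transform does not exceed `f*` on `M`.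
  -- Subtracting `F y₀` changes nothing in the functional because `m` and `ν` have equal mass.
  set F : E → ℝ := legendre fun x : M => legendre f x with hF
  have hlipM : LipschitzWith R fun y : M => F y - F y₀ := LipschitzWith.of_dist_le_mul fun y z => by
    rw [Real.dist_eq, sub_sub_sub_cancel_right, ← Real.dist_eq]
    exact hlip.dist_le_mul y z
  refine ⟨BoundedContinuousFunction.mkOfCompact ⟨_, hlipM.continuous⟩, hlipM, by simp, ?_⟩
  set g : M →ᵇ ℝ := BoundedContinuousFunction.mkOfCompact ⟨_, hlipM.continuous⟩ with hg
  have hgF (y : M) : g y = F y - F y₀ := rfl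
  have h1 : ∫ x, legendre g x ∂m ≤ ∫ x, (legendre f x + F y₀) ∂m := by
    refine integral_mono_ae (integrable_legendre hM hmM g)
      ((integrable_legendre hM hmM f).add (integrable_const _)) ?_
    filter_upwards [show ∀ᵐ x ∂m, x ∈ M from hmM] with x hx
    refine legendre_le fun y => ?_
    have := inner_sub_le_legendre hR hb1 (y : E) ⟨x, hx⟩
    rw [← hF, real_inner_comm] at this
    rw [hgF]
    simp only at this ⊢
    linarith
  have h2 : ∫ y, (g y + F y₀) ∂ν ≤ ∫ y, f y ∂ν :=
    integral_mono ((g.integrable ν).add (integrable_const _)) (f.integrable ν) fun y => by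
      have := legendre_legendre_le hR hb y
      simp only [hgF, sub_add_cancel]
      exact this
  rw [integral_add (integrable_legendre hM hmM f) (integrable_const _)] at h1
  rw [integral_add (g.integrable ν) (integrable_const _)] at h2
  simp only [integral_const, probReal_univ, one_smul] at h1 h2
  simp only [dualFunctional]
  linarith

theorem exists_dualFunctional_le [Nonempty M] (hM : IsCompact M) (hmM : m Mᶜ = 0) :
    ∃ f : M →ᵇ ℝ, ∀ g, dualFunctional m ν f ≤ dualFunctional m ν g := by
  have := isCompact_iff_compactSpace.1 hM
  obtain ⟨R, hR0, hR⟩ := hM.isBounded.exists_pos_norm_le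
  lift R to ℝ≥0 using hR0.le
  obtain ⟨y₀⟩ := ‹Nonempty M›
  have hcont : Continuous (dualFunctional m ν) := by
    have : Nonempty M := ⟨y₀⟩
    exact (LipschitzWith.of_le_add_mul 2 fun f g => dualFunctional_le_add hM hmM f g).continuous
  -- By the previous lemma it suffices to minimise over this set, which is compact by Arzelà–Ascoli.
  set K : Set (M →ᵇ ℝ) := {f | (∀ y z, dist (f y) (f z) ≤ R * dist y z) ∧ f y₀ = 0} with hK
  have hKcomp : IsCompact K := by
    refine BoundedContinuousFunction.arzela_ascoli₂ (Metric.closedBall 0 (R * Metric.diam M))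
      (isCompact_closedBall _ _) K ?_ (fun f y hf => ?_) ?_
    · have hev (y : M) : Continuous fun f : M →ᵇ ℝ => f y :=
        BoundedContinuousFunction.lipschitz_eval_const y |>.continuous
      have : K = (⋂ y, ⋂ z, {f | dist (f y) (f z) ≤ R * dist y z}) ∩ {f | f y₀ = 0} := by
        ext f
        simp [hK]
      rw [this]
      exact (isClosed_iInter fun y => isClosed_iInter fun z =>
        isClosed_le ((hev y).dist (hev z)) continuous_const).inter
          (isClosed_eq (hev y₀) continuous_const)
    · have h1 := hf.1 y y₀
      rw [hf.2] at h1
      exact h1.trans (mul_le_mul_of_nonneg_left (Metric.dist_le_diam_of_mem hM.isBounded y.2 y₀.2)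
        R.2)
    · exact (LipschitzWith.uniformEquicontinuous _ R fun f : K =>
        LipschitzWith.of_dist_le_mul f.2.1).equicontinuous
  obtain ⟨f, -, hf⟩ := hKcomp.exists_isMinOn ⟨0, by simp [hK]; intros; positivity⟩
    hcont.continuousOn
  refine ⟨f, fun g => ?_⟩
  obtain ⟨g', hg1, hg2, hg3⟩ := exists_lipschitzWith_dualFunctional_le (ν := ν) hM hmM hR y₀ g
  exact (hf ⟨fun y z => hg1.dist_le_mul y z, hg2⟩).trans hg3

/-- The first variation of the dual functional at a minimiser, in one direction. -/
theorem integral_comp_le_of_minimizer [Nonempty M] (hM : IsCompact M) (hmM : m Mᶜ = 0)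
    {f : M →ᵇ ℝ} (hf : ∀ g, dualFunctional m ν f ≤ dualFunctional m ν g) {T : E → M}
    (hT : ∀ᵐ x ∂m, ∀ y : M, legendre f x = ⟪x, (y : E)⟫ - f y → y = T x) (g : M →ᵇ ℝ) :
    ∫ x, g (T x) ∂m ≤ ∫ y, g y ∂ν := by
  obtain ⟨R, hR0, hR⟩ := hM.isBounded.exists_pos_norm_le
  set t : ℕ → ℝ := fun k => 1 / ((k : ℝ) + 1) with ht_def
  have ht (k : ℕ) : 0 < t k := by positivity
  have ht0 : Tendsto t atTop (𝓝 0) := tendsto_one_div_add_atTop_nhds_zero_nat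
  have hint (k : ℕ) : Integrable (fun x => (t k)⁻¹ * (legendre (f + t k • g) x - legendre f x)) m :=
    ((integrable_legendre hM hmM (f + t k • g)).sub (integrable_legendre hM hmM f)).const_mul _
  have hlim : Tendsto (fun k => ∫ x, (t k)⁻¹ * (legendre (f + t k • g) x - legendre f x) ∂m) atTop
      (𝓝 (∫ x, -g (T x) ∂m)) := by
    refine tendsto_integral_of_dominated_convergence (fun _ => ‖g‖) (fun k => (hint k).1)
      (integrable_const _) (fun k => Eventually.of_forall fun x => ?_) ?_
    · have h1 := abs_legendre_sub_le_dist hR hM (f + t k • g) f x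
      rw [dist_eq_norm, add_sub_cancel_left, norm_smul, Real.norm_of_nonneg (ht k).le] at h1
      rw [norm_mul, norm_inv, Real.norm_of_nonneg (ht k).le, ← div_eq_inv_mul,
        div_le_iff₀ (ht k), mul_comm]
      exact h1
    · filter_upwards [hT] with x hx using tendsto_legendre_slope hR hM f g hx ht ht0
  have hge (k : ℕ) : -∫ y, g y ∂ν ≤ ∫ x, (t k)⁻¹ * (legendre (f + t k • g) x - legendre f x) ∂m := by
    have h1 := hf (f + t k • g)
    simp only [dualFunctional, BoundedContinuousFunction.coe_add,
      BoundedContinuousFunction.coe_smul, Pi.add_apply, smul_eq_mul] at h1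
    rw [integral_add (f.integrable ν) ((g.integrable ν).const_mul _), integral_const_mul] at h1
    rw [integral_const_mul, integral_sub (integrable_legendre hM hmM (f + t k • g))
      (integrable_legendre hM hmM f), ← div_eq_inv_mul, le_div_iff₀ (ht k)]
    simp only [BoundedContinuousFunction.coe_add, BoundedContinuousFunction.coe_smul]
    simp only [Pi.add_def, smul_eq_mul] at h1 ⊢
    linarith
  have h := ge_of_tendsto' hlim hge
  rw [integral_neg] at h
  linarith

/-- The one-sided variation applied to both `g` and `-g`. -/
theorem integral_comp_eq_of_minimizer [Nonempty M] (hM : IsCompact M) (hmM : m Mᶜ = 0)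
    {f : M →ᵇ ℝ} (hf : ∀ g, dualFunctional m ν f ≤ dualFunctional m ν g) {T : E → M}
    (hT : ∀ᵐ x ∂m, ∀ y : M, legendre f x = ⟪x, (y : E)⟫ - f y → y = T x) (g : M →ᵇ ℝ) :
    ∫ x, g (T x) ∂m = ∫ y, g y ∂ν := by
  refine le_antisymm (integral_comp_le_of_minimizer hM hmM hf hT g) ?_
  have := integral_comp_le_of_minimizer hM hmM hf hT (-g)
  simp only [BoundedContinuousFunction.coe_neg, Pi.neg_apply, integral_neg] at this
  linarith

end DualProblem

/-! ### Existence of the Brenier potential -/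

section Brenier

variable {n : ℕ} {M : Set (EuclideanSpace ℝ (Fin n))} {m μ : Measure (EuclideanSpace ℝ (Fin n))}
  [IsProbabilityMeasure m] [IsProbabilityMeasure μ]

/-- Existence of a Brenier potential. -/
theorem exists_isHalfSqDistConvex_map_eq [Nonempty M] (hM : IsCompact M) (hMc : Convex ℝ M)
    (hm : m ≪ volume) (hmM : m Mᶜ = 0) (hμ : μ Mᶜ = 0) :
    ∃ φ, IsHalfSqDistConvex M φ ∧ m.map (expGrad M φ) = μ := by
  obtain ⟨R, hR0, hR⟩ := hM.isBounded.exists_pos_norm_le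
  lift R to ℝ≥0 using hR0.le
  have hemb := MeasurableEmbedding.subtype_coe hM.measurableSet
  have hμmap : (μ.comap (Subtype.val : M → _)).map Subtype.val = μ := by
    rw [hemb.map_comap, Subtype.range_coe]
    exact Measure.restrict_eq_self_of_ae_mem hμ
  have hprob : IsProbabilityMeasure (μ.comap (Subtype.val : M → _)) := by
    constructor
    rw [hemb.comap_apply, image_univ, Subtype.range_coe]
    exact (prob_compl_eq_zero_iff hM.measurableSet).1 hμ
  obtain ⟨f, hf⟩ := exists_dualFunctional_le (m := m) (ν := μ.comap (Subtype.val : M → _)) hM hmM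
  have hb := bddBelow_range_of_continuous hM f.continuous
  have hlip := lipschitzWith_legendre hR hb
  have hd := hlip.ae_differentiableAt_of_absolutelyContinuous hm
  -- `T` is an arbitrary selection, with no measurability; the gradient, equal to it almost
  -- everywhere, is its measurable version.
  choose T hT using exists_legendre_eq (f := f) hM f.continuous
  have hTgrad : ∀ᵐ x ∂m, ∀ y : M, legendre f x = ⟪x, (y : EuclideanSpace ℝ (Fin n))⟫ - f y →
      gradient (legendre f) x = y := by
    filter_upwards [hd] with x hx y hy using eq_gradient_of_legendre_eq hR hb hy hx
  have hTuniq : ∀ᵐ x ∂m, ∀ y : M,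
      legendre f x = ⟪x, (y : EuclideanSpace ℝ (Fin n))⟫ - f y → y = T x := by
    filter_upwards [hTgrad] with x hx y hy
    exact Subtype.ext ((hx y hy).symm.trans (hx _ (hT x)))
  refine ⟨_, isHalfSqDistConvex_of_legendre hM f.continuous, ?_⟩
  have hae := expGrad_ae_eq_gradient hm hMc hmM
    (φ := fun x => legendre f x - ‖x‖ ^ 2 / 2) (fun _ _ => rfl) hlip
  rw [Measure.map_congr hae]
  have hmeas := (measurable_gradient (legendre f)).aemeasurable (μ := m)
  have := Measure.isProbabilityMeasure_map hmeas
  refine ext_of_forall_integral_eq_of_IsFiniteMeasure fun g => ?_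
  rw [integral_map hmeas g.continuous.aestronglyMeasurable]
  have h1 := integral_comp_eq_of_minimizer hM hmM hf hTuniq
    (g.compContinuous ⟨Subtype.val, continuous_subtype_val⟩)
  have h2 : ∫ x, g (gradient (legendre f) x) ∂m = ∫ x, g (T x) ∂m := by
    refine integral_congr_ae ?_
    filter_upwards [hTgrad] with x hx
    rw [hx _ (hT x)]
  rw [h2]
  refine h1.trans ?_
  conv_rhs => rw [← hμmap, hemb.integral_map]
  rfl

theorem brenierPotential_spec [Nonempty M] (hM : IsCompact M) (hMc : Convex ℝ M)
    (hm : m ≪ volume) (hmM : m Mᶜ = 0) (hμ : μ Mᶜ = 0) :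
    IsHalfSqDistConvex M (brenierPotential M m μ) ∧
      m.map (expGrad M (brenierPotential M m μ)) = μ :=
  Classical.epsilon_spec (exists_isHalfSqDistConvex_map_eq hM hMc hm hmM hμ)

/-- The transport maps to `μ` and to its conjugate measure are the gradients of a pair of mutually
conjugate convex functions. -/
theorem exists_isLegendrePair_map_gradient_eq [Nonempty M] (hM : IsCompact M) (hMc : Convex ℝ M)
    (hm : m ≪ volume) (hmM : m Mᶜ = 0) (hμ : μ Mᶜ = 0) :
    ∃ u w, IsLegendrePair M u w ∧ m.map (gradient u) = μ ∧
      m.map (gradient w) = conjMeasure M m μ := by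
  obtain ⟨R, hR0, hR⟩ := hM.isBounded.exists_pos_norm_le
  lift R to ℝ≥0 using hR0.le
  obtain ⟨hφ, hmap⟩ := brenierPotential_spec hM hMc hm hmM hμ
  obtain ⟨u, w, huw, hu, hw⟩ := hφ.exists_isLegendrePair hM
  refine ⟨u, w, huw, ?_, ?_⟩
  · rw [← Measure.map_congr (expGrad_ae_eq_gradient hm hMc hmM hu (huw.lipschitzWith_left hM hR)),
      hmap]
  · exact (Measure.map_congr (expGrad_ae_eq_gradient hm hMc hmM (fun y _ => hw y)
      (huw.symm.lipschitzWith_left hM hR))).symm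

end Brenier

/-! ### The two statements on the conjugate measure -/

theorem IsDiscreteMeasure.exists_countable {n : ℕ} {μ : Measure (EuclideanSpace ℝ (Fin n))}
    (hμ : IsDiscreteMeasure μ) : ∃ D : Set (EuclideanSpace ℝ (Fin n)), D.Countable ∧ μ Dᶜ = 0 := by
  obtain ⟨c, z, rfl⟩ := hμ
  refine ⟨range z, countable_range z, ?_⟩
  simp [Measure.sum_apply _ (countable_range z).measurableSet.compl,
    Measure.dirac_apply' _ (countable_range z).measurableSet.compl]

theorem corollary4p3 (n : ℕ) (hn : 1 ≤ n)
    (M : Set (EuclideanSpace ℝ (Fin n))) (hMcompact : IsCompact M) (hMconvex : Convex ℝ M)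
    (m : Measure (EuclideanSpace ℝ (Fin n))) [IsProbabilityMeasure m]
    (hm_ac : m ≪ volume) (hm_supp : m.support = M)
    (μ : Measure (EuclideanSpace ℝ (Fin n))) [IsProbabilityMeasure μ] (hμ : μ Mᶜ = 0) :
    (IsDiscreteMeasure μ →
      m (conjMeasure M m μ).support = 0 ∧
      ∀ ν : Measure (EuclideanSpace ℝ (Fin n)), ν ≤ conjMeasure M m μ → ν ≪ m → ν = 0) ∧
    (μ.support = M → ∀ x : EuclideanSpace ℝ (Fin n), conjMeasure M m μ {x} = 0) := by
  -- Positive dimension makes points Lebesgue-null, hence `m`-null.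
  have : Nonempty (Fin n) := ⟨⟨0, hn⟩⟩
  have hmM : m Mᶜ = 0 := hm_supp ▸ Measure.measure_compl_support
  have : Nonempty M := (hm_supp ▸ Measure.nonempty_support (IsProbabilityMeasure.ne_zero m) :
    M.Nonempty).to_subtype
  have : NullSingletonClass m := ⟨fun x => hm_ac (measure_singleton x)⟩
  obtain ⟨u, w, huw, hu, hw⟩ := exists_isLegendrePair_map_gradient_eq hMcompact hMconvex hm_ac hmM hμ
  rw [← hw]
  refine ⟨fun hdisc => ?_, fun hsupp x => ?_⟩
  · obtain ⟨D, hD, hμD⟩ := hdisc.exists_countable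
    have huD : ∀ᵐ x ∂m, gradient u x ∈ D := by
      rw [← hu, Measure.map_apply (measurable_gradient u) hD.measurableSet.compl] at hμD
      exact hμD
    obtain ⟨O, hO, hmO, hwO⟩ :=
      huw.exists_isOpen_of_countable hMcompact hMconvex hm_ac hmM hD huD
    have hnull : m.map (gradient w) O = 0 := by
      rw [Measure.map_apply (measurable_gradient w) hO.measurableSet]
      exact measure_eq_zero_iff_ae_notMem.2 hwO
    have hsub := Measure.subset_compl_support_of_isOpen hO hnull
    have hsupp0 : m (m.map (gradient w)).support = 0 :=
      measure_mono_null (subset_compl_comm.1 hsub) hmO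
    refine ⟨hsupp0, fun ν hν hνm => Measure.measure_univ_eq_zero.1 ?_⟩
    -- On the support `ν` vanishes by absolute continuity, off it by domination.
    rw [← union_compl_self (m.map (gradient w)).support]
    exact measure_union_null (hνm hsupp0)
      (nonpos_iff_eq_zero.1 ((hν _).trans Measure.measure_compl_support.le))
  · rw [Measure.map_apply (measurable_gradient w) (measurableSet_singleton x)]
    refine measure_eq_zero_iff_ae_notMem.2
      (huw.measure_gradient_eq_null hMcompact hMconvex hm_ac hmM (fun V hV hVne hVM hVnull => ?_) x)
    obtain ⟨y, hy⟩ := hVne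
    have hpos := (Measure.mem_support_iff_forall y).1 (hsupp ▸ hVM hy) V (hV.mem_nhds hy)
    rw [← hu, Measure.map_apply (measurable_gradient u) hV.measurableSet] at hpos
    exact hpos.ne' (measure_eq_zero_iff_ae_notMem.2 hVnull)
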